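/- Let $0<\alpha\le 2$ and let $M$ be a symmetric $\alpha$-stable random measure on $\mathbb{R}$ with Lebesgue control measure: an independently scattered, almost surely $\sigma$-additive random set function on the Borel sets of finite Lebesgue measure such that $M(A)$ has characteristic function $\theta\mapsto\exp(-|A|\,|\theta|^{\alpha})$, where $|A|$ is the Lebesgue measure of $A$. Write $M(t)=\int_0^t M(dx)$ for the associated stable Lévy motion ($t\in\mathbb{R}$), so that $M(t)-M(s)=M((s,t])$ almost surely for $s\le t$. For $f\in L^{\alpha}(\mathbb{R})$ let $\int f\,dM$ be the stable stochastic integral, that is, the limit in probability of the integrals of simple functions converging to $f$ in $L^{\alpha}$. The $\alpha$-norm $\|X\|_{\alpha}$ of a symmetric $\alpha$-stable random variable $X$ is its scale parameter, i.e. the unique $\sigma\ge 0$ such that $X$ has characteristic function $\theta\mapsto\exp(-\sigma^{\alpha}|\theta|^{\alpha})$. Let $g:\mathbb{R}\to\mathbb{R}$ be measurable with $\int_{\mathbb{R}}|g|^{\alpha}<\infty$. Suppose that $c_0^+,c_0^-,\gamma,a,c,\eta\in\mathbb{R}$ satisfy $c>0$, $\eta>0$ and $0<\gamma+1/\alpha<a\le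 1$, that $$\frac{g(r)}{r^{\gamma}}\to c_0^+\quad\text{and}\quad \frac{g(-r)}{r^{\gamma}}\to c_0^-\qquad\text{as } r\searrow 0,$$ and that $$|g(u+h)-g(u)|\le c\,|h|^{a}\,|u|^{\gamma-a}\qquad\text{for all } u\in\mathbb{R}\setminus\{0\}\text{ and } |h|<\eta .$$ Let $Y(t)=\int_{\mathbb{R}} g(t-x)\,M(dx)$ for $t\in\mathbb{R}$ and, for $\omega,\Omega\in\mathbb{N}$ with $\omega>0$ and $k\in\mathbb{Z}$, let $$Y_{\omega,\Omega}(k)=\sum_{j=-\omega\Omega+1}^{0} g\Big(\frac{j-1}{\omega}\Big)Z_{\alpha,\omega}(\omega k-j)+\sum_{j=1}^{\omega\Omega} g\Big(\frac{j}{\omega}\Big)Z_{\alpha,\omega}(\omega k-j),\qquad Z_{\alpha,\omega}(j)=M\Big(\frac{j+1}{\omega}\Big)-M\Big(\frac{j}{\omega}\Big).$$ Then, for all $\omega,\Omega\in\mathbb{N}$ with $\omega>1/\eta$ and all $k\in\mathbb{Z}$, the random variable $Y(k)-Y_{\omega,\Omega}(k)$ is symmetric $\alpha$-stable and $$\|Y(k)-Y_{\omega,\Omega}(k)\|_{\alpha}\le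 A_{\omega,\Omega}^{1/\alpha},$$ where $$A_{\omega,\Omega}=\frac{2c^{\alpha}}{(1+a\alpha)\,\omega^{1+\gamma\alpha}}\sum_{j=1}^{\omega\Omega}\frac{1}{j^{(a-\gamma)\alpha}}+\int_{-\infty}^{-\Omega}|g(s)|^{\alpha}\,ds+\int_{\Omega}^{+\infty}|g(s)|^{\alpha}\,ds .$$ -/

import Mathlib

open MeasureTheory ProbabilityTheory Filter Topology
open scoped ENNReal

/-- `HasSymStableLaw α σ P X`: under `P`, the random variable `X` has the symmetric stable law
`S_α(σ, 0, 0)`, that is, the characteristic function `t ↦ exp (-σ^α |t|^α)` with scale `σ ≥ 0`. -/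
structure HasSymStableLaw {S : Type*} [MeasurableSpace S]
    (α σ : ℝ) (P : Measure S) (X : S → ℝ) : Prop where
  aemeasurable : AEMeasurable X P
  scale_nonneg : 0 ≤ σ
  charFun_eq : ∀ t : ℝ, charFun (P.map X) t = ((Real.exp (-(σ ^ α * |t| ^ α)) : ℝ) : ℂ)

/-- The scale parameter is determined by the law. -/
theorem HasSymStableLaw.scale_unique {S : Type*} [MeasurableSpace S] {α σ τ : ℝ}
    {P : Measure S} {X : S → ℝ} (hα : 0 < α)
    (h₁ : HasSymStableLaw α σ P X) (h₂ : HasSymStableLaw α τ P X) : σ = τ := by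
  have h := (h₁.charFun_eq 1).symm.trans (h₂.charFun_eq 1)
  simp only [abs_one, Real.one_rpow, mul_one, Complex.ofReal_inj, Real.exp_eq_exp,
    neg_inj] at h
  exact (Real.rpow_left_inj h₁.scale_nonneg h₂.scale_nonneg hα.ne').1 h

/-- The `α`-norm `‖X‖_α` of a symmetric `α`-stable random variable `X`: its scale parameter
(unique when `X` is symmetric `α`-stable, see `alphaNorm_eq`). -/
noncomputable def alphaNorm {S : Type*} [MeasurableSpace S]
    (α : ℝ) (P : Measure S) (X : S → ℝ) : ℝ :=
  sInf {σ : ℝ | HasSymStableLaw α σ P X}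

theorem alphaNorm_eq {S : Type*} [MeasurableSpace S] {α σ : ℝ}
    {P : Measure S} {X : S → ℝ} (hα : 0 < α) (h : HasSymStableLaw α σ P X) :
    alphaNorm α P X = σ := by
  have hs : {τ : ℝ | HasSymStableLaw α τ P X} = {σ} :=
    Set.eq_singleton_iff_unique_mem.2 ⟨h, fun _ hτ => HasSymStableLaw.scale_unique hα hτ h⟩
  simp [alphaNorm, hs]

/-- `M` is a symmetric `α`-stable random measure on `ℝ` with Lebesgue control measure: an
independently scattered, almost surely `σ`-additive set function, with
`M(A) ~ S_α(|A|^{1/α}, 0, 0)`. Only the values `M A` on Borel sets `A` of finite Lebesgue measure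
are meaningful. The series in `sigma_additive` converges as an ordered series (it need not
converge absolutely when `α ≥ 1`). -/
structure IsSymStableRandomMeasure {S : Type*} [MeasurableSpace S]
    (α : ℝ) (P : Measure S) (M : Set ℝ → S → ℝ) : Prop where
  measurable : ∀ A : Set ℝ, MeasurableSet A → volume A < ∞ → Measurable (M A)
  law : ∀ A : Set ℝ, MeasurableSet A → volume A < ∞ →
    HasSymStableLaw α ((volume A).toReal ^ (1 / α)) P (M A)
  indep : ∀ (n : ℕ) (A : Fin n → Set ℝ), (∀ i, MeasurableSet (A i)) →
    (∀ i, volume (A i) < ∞) → Pairwise (fun i j => Disjoint (A i) (A j)) →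
    iIndepFun (fun i => M (A i)) P
  sigma_additive : ∀ A : ℕ → Set ℝ, (∀ i, MeasurableSet (A i)) →
    Pairwise (fun i j => Disjoint (A i) (A j)) → volume (⋃ i, A i) < ∞ →
    ∀ᵐ s ∂P, Tendsto (fun n : ℕ => ∑ i ∈ Finset.range n, M (A i) s) atTop (𝓝 (M (⋃ i, A i) s))

/-- The integral `∑ c · M(f = c)` of a simple function `f`. For `f` in `L^α` all level sets with
`c ≠ 0` have finite measure, and the term `c = 0` vanishes. -/
noncomputable def simpleStableIntegral {S : Type*}
    (M : Set ℝ → S → ℝ) (f : SimpleFunc ℝ ℝ) (s : S) : ℝ :=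
  ∑ c ∈ f.range, c * M (f ⁻¹' {c}) s

/-- `X` is (a version of) the stable integral `∫ f dM`: the limit in probability of the integrals
of simple functions in `L^α` that converge to `f` in `L^α`. -/
def IsStableIntegral {S : Type*} [MeasurableSpace S]
    (α : ℝ) (P : Measure S) (M : Set ℝ → S → ℝ) (f : ℝ → ℝ) (X : S → ℝ) : Prop :=
  Measurable X ∧ ∃ φ : ℕ → SimpleFunc ℝ ℝ,
    (∀ n, MemLp (φ n) (ENNReal.ofReal α) volume) ∧
    Tendsto (fun n => eLpNorm (fun x => f x - φ n x) (ENNReal.ofReal α) volume) atTop (𝓝 0) ∧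
    TendstoInMeasure P (fun n => simpleStableIntegral M (φ n)) atTop X

open Classical in
/-- The stable stochastic integral `∫ f dM` (with the value `0` if no such limit exists). -/
noncomputable def stableIntegral {S : Type*} [MeasurableSpace S]
    (α : ℝ) (P : Measure S) (M : Set ℝ → S → ℝ) (f : ℝ → ℝ) : S → ℝ :=
  if h : ∃ X : S → ℝ, IsStableIntegral α P M f X then h.choose else 0

/-- The moving average process `Y(t) = ∫ g(t - x) M(dx)`. -/
noncomputable def movingAverage {S : Type*} [MeasurableSpace S]
    (α : ℝ) (P : Measure S) (M : Set ℝ → S → ℝ) (g : ℝ → ℝ) (t : ℝ) : S → ℝ :=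
  stableIntegral α P M (fun x => g (t - x))

/-- The stable Lévy motion `t ↦ ∫_0^t M(dx)` on `ℝ`, whose value at `t` is also written `M(t)`. -/
noncomputable def stableLevyMotion {S : Type*}
    (M : Set ℝ → S → ℝ) (t : ℝ) (s : S) : ℝ :=
  if 0 ≤ t then M (Set.Ioc 0 t) s else -M (Set.Ioc t 0) s

/-- The increment `Z_{α,ω}(j) = M((j+1)/ω) - M(j/ω)`. -/
noncomputable def stableIncrement {S : Type*}
    (M : Set ℝ → S → ℝ) (ω : ℕ) (j : ℤ) (s : S) : ℝ :=
  stableLevyMotion M (((j : ℝ) + 1) / ω) s - stableLevyMotion M ((j : ℝ) / ω) s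

/-- The Riemann sum approximation `Y_{ω,Ω}(k)` with step `1/ω` and cut-off `Ω`. -/
noncomputable def movingAverageApprox {S : Type*}
    (M : Set ℝ → S → ℝ) (g : ℝ → ℝ) (ω Ω : ℕ) (k : ℤ) (s : S) : ℝ :=
  (∑ j ∈ Finset.Icc (-((ω : ℤ) * Ω) + 1) 0,
      g (((j : ℝ) - 1) / ω) * stableIncrement M ω (ω * k - j) s) +
    ∑ j ∈ Finset.Icc (1 : ℤ) ((ω : ℤ) * Ω),
      g ((j : ℝ) / ω) * stableIncrement M ω (ω * k - j) s

/-- The quantity `A_{ω,Ω}` that bounds the `α`-th power of the approximation error. -/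
noncomputable def errorBound (α : ℝ) (g : ℝ → ℝ) (γ a c : ℝ) (ω Ω : ℕ) : ℝ :=
  2 * c ^ α / ((1 + a * α) * (ω : ℝ) ^ (1 + γ * α)) *
      (∑ j ∈ Finset.Icc 1 (ω * Ω), 1 / (j : ℝ) ^ ((a - γ) * α)) +
    (∫ s in Set.Iic (-(Ω : ℝ)), |g s| ^ α) + ∫ s in Set.Ici (Ω : ℝ), |g s| ^ α

/-! The integral of a simple function is a finite sum of independent stable variables, so its
characteristic function shows that it is symmetric stable with scale the `L^α` norm of the integrand
(`hasSymStableLaw_simpleStableIntegral`). This isometry survives limits in probability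
(`hasSymStableLaw_of_isStableIntegral`), because the `L^α` quasi-norm is continuous. The Riemann sum
is almost surely the integral of a step function `ψ`, so `Y(k) - Y_{ω,Ω}(k)` is the stable integral
of `g(k - ·) - ψ`, and its scale is the `L^α` norm of that function.

After the substitution `s = k - x` this norm is estimated on cells of length `1/ω`
(`lintegral_step_error_le`). In each cell of `[-Ω, Ω)` the node `u` is the endpoint farther from the
origin, so `|u| = m/ω` with `m ≥ 1`, and the increment condition based at `u` gives `|g s - g u|^α ≤
c^α |s - u|^(aα) |u|^((γ-a)α)`. Integrating over the cell yields the `m`-th term of the sum; each `m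
≤ ωΩ` occurs once on either side of `0`, hence the factor `2`. Outside `[-Ω, Ω)` the step function
vanishes and the tails of `|g|^α` remain. -/

namespace HasSymStableLaw

variable {S : Type*} [MeasurableSpace S] {α σ : ℝ} {P : Measure S} {X Y : S → ℝ}

theorem congr_ae (h : HasSymStableLaw α σ P X) (hXY : X =ᵐ[P] Y) : HasSymStableLaw α σ P Y where
  aemeasurable := h.aemeasurable.congr hXY
  scale_nonneg := h.scale_nonneg
  charFun_eq t := by rw [← Measure.map_congr hXY]; exact h.charFun_eq t

theorem ae_eq_zero [IsProbabilityMeasure P] (hα : 0 < α) (h : HasSymStableLaw α 0 P X) :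
    X =ᵐ[P] 0 := by
  have := Measure.isProbabilityMeasure_map h.aemeasurable
  have h1 : P.map X = Measure.dirac 0 := by
    apply Measure.ext_of_charFun
    ext t
    rw [h.charFun_eq, charFun_dirac]
    simp [Real.zero_rpow hα.ne']
  have h2 : ∀ᵐ x ∂(P.map X), x = 0 := by
    rw [h1]; simp
  exact ae_of_ae_map h.aemeasurable h2

end HasSymStableLaw

/-! ### Finite additivity and integrals of simple functions. -/

namespace IsSymStableRandomMeasure

variable {S : Type*} [MeasurableSpace S] {P : Measure S} {α : ℝ} {M : Set ℝ → S → ℝ}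

theorem measurable_simpleStableIntegral (hM : IsSymStableRandomMeasure α P M) (hα : 0 < α)
    (φ : SimpleFunc ℝ ℝ) (hφ : MemLp φ (ENNReal.ofReal α) volume) :
    Measurable (simpleStableIntegral M φ) := by
  have hfin := SimpleFunc.measure_preimage_lt_top_of_memLp (by simpa using hα) (by simp) _ hφ
  unfold simpleStableIntegral
  refine Finset.measurable_fun_sum _ fun c _ => ?_
  by_cases hc : c = 0
  · simp [hc]
  · exact (hM.measurable _ (φ.measurableSet_preimage _) (hfin c hc)).const_mul c

/-- The integral of a simple function is symmetric stable with scale its `L^α` norm. -/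
theorem hasSymStableLaw_simpleStableIntegral (hM : IsSymStableRandomMeasure α P M) (hα : 0 < α)
    (φ : SimpleFunc ℝ ℝ) (hφ : MemLp φ (ENNReal.ofReal α) volume) :
    HasSymStableLaw α (eLpNorm φ (ENNReal.ofReal α) volume).toReal P
      (simpleStableIntegral M φ) where
  aemeasurable := (hM.measurable_simpleStableIntegral hα φ hφ).aemeasurable
  scale_nonneg := ENNReal.toReal_nonneg
  charFun_eq t := by
    classical
    have hfin := SimpleFunc.measure_preimage_lt_top_of_memLp (by simpa using hα) (by simp) _ hφ
    -- The value `0` is dropped: its level set has infinite measure, so nothing is known about `M`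
    -- there.
    let R := φ.range.erase 0
    let A : R → Set ℝ := fun c => φ ⁻¹' {(c : ℝ)}
    have hAm : ∀ c, MeasurableSet (A c) := fun c => φ.measurableSet_preimage _
    have hAv : ∀ c, volume (A c) < ∞ := fun c => hfin c (Finset.ne_of_mem_erase c.2)
    have hAd : Pairwise (fun i j => Disjoint (A i) (A j)) := fun i j hij =>
      Disjoint.preimage _ (Set.disjoint_singleton.2 fun h => hij (Subtype.ext h))
    have hind : iIndepFun (fun c : R => M (A c)) P := by
      let e := Fintype.equivFin R
      have h := hM.indep _ (A ∘ e.symm) (fun i => hAm _) (fun i => hAv _)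
        (fun i j hij => hAd (by simpa using hij))
      have h' := h.precomp e.injective
      simpa [Function.comp_def] using h'
    have hind' : iIndepFun (fun (c : R) s => (c : ℝ) * M (A c) s) P :=
      hind.comp (fun c x => (c : ℝ) * x) (fun c => measurable_const_mul _)
    have hI : simpleStableIntegral M φ = fun s => ∑ c : R, (c : ℝ) * M (A c) s := by
      ext s
      rw [simpleStableIntegral, ← Finset.sum_erase (a := 0) _ (by simp)]
      exact (Finset.sum_coe_sort R (fun c => c * M (φ ⁻¹' {c}) s)).symm
    have hmeas : ∀ c, Measurable (M (A c)) := fun c => hM.measurable _ (hAm c) (hAv c)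
    have hscale : (eLpNorm φ (ENNReal.ofReal α) volume).toReal ^ α =
        ∑ c : R, |(c : ℝ)| ^ α * (volume (A c)).toReal := by
      have h1 : ∫⁻ x, ‖φ x‖ₑ ^ α = ∑ c ∈ φ.range, ‖c‖ₑ ^ α * volume (φ ⁻¹' {c}) := by
        rw [← SimpleFunc.map_lintegral, ← SimpleFunc.lintegral_eq_lintegral]
        rfl
      rw [eLpNorm_eq_lintegral_rpow_enorm_toReal (by simpa using hα) (by simp),
        ENNReal.toReal_ofReal hα.le, ← ENNReal.toReal_rpow, ← Real.rpow_mul ENNReal.toReal_nonneg,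
        one_div_mul_cancel hα.ne', Real.rpow_one, h1,
        ← Finset.sum_erase (a := 0) _ (by simp [hα]), ENNReal.toReal_sum]
      · rw [← Finset.sum_coe_sort]
        refine Finset.sum_congr rfl fun c _ => ?_
        simp [A, ENNReal.toReal_mul, ← ENNReal.toReal_rpow]
      · intro c hc
        exact ENNReal.mul_ne_top (ENNReal.rpow_ne_top_of_nonneg hα.le (by simp))
          (hfin c (Finset.ne_of_mem_erase hc)).ne
    rw [hI, hind'.charFun_map_fun_sum_eq_prod (fun c => ((hmeas c).const_mul _).aemeasurable),
      hscale, Finset.prod_apply]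
    rw [Finset.sum_mul, ← Finset.sum_neg_distrib, Real.exp_sum, Complex.ofReal_prod]
    refine Finset.prod_congr rfl fun c _ => ?_
    rw [charFun_map_mul_comp (hmeas c).aemeasurable, (hM.law _ (hAm c) (hAv c)).charFun_eq,
      ← Real.rpow_mul ENNReal.toReal_nonneg, one_div_mul_cancel hα.ne', Real.rpow_one, abs_mul,
      Real.mul_rpow (abs_nonneg _) (abs_nonneg _)]
    congr 3
    ring

variable [IsProbabilityMeasure P]

theorem ae_empty (hM : IsSymStableRandomMeasure α P M) (hα : 0 < α) : M ∅ =ᵐ[P] 0 := by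
  have h := hM.law ∅ MeasurableSet.empty (by simp)
  rw [measure_empty, ENNReal.toReal_zero, Real.zero_rpow (by positivity)] at h
  exact h.ae_eq_zero hα

theorem ae_union (hM : IsSymStableRandomMeasure α P M) (hα : 0 < α) {A B : Set ℝ}
    (hA : MeasurableSet A) (hB : MeasurableSet B) (hAB : Disjoint A B)
    (hAv : volume A < ∞) (hBv : volume B < ∞) : M (A ∪ B) =ᵐ[P] fun s => M A s + M B s := by
  -- Finite additivity comes from σ-additivity for the sequence `A, B, ∅, ∅, …`, since `M ∅`
  -- vanishes almost surely.
  let C : ℕ → Set ℝ := fun n => if n = 0 then A else if n = 1 then B else ∅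
  have hU : ⋃ i, C i = A ∪ B := by
    ext x
    simp only [Set.mem_iUnion, Set.mem_union]
    constructor
    · rintro ⟨i, hi⟩
      by_cases h0 : i = 0
      · left; simpa [C, h0] using hi
      · by_cases h1 : i = 1
        · right; simpa [C, h1] using hi
        · simp [C, h0, h1] at hi
    · rintro (h | h)
      · exact ⟨0, by simpa [C] using h⟩
      · exact ⟨1, by simpa [C] using h⟩
  have hm : ∀ i, MeasurableSet (C i) := by
    intro i
    simp only [C]
    split_ifs
    · exact hA
    · exact hB
    · exact MeasurableSet.empty
  have hd : Pairwise (fun i j => Disjoint (C i) (C j)) := by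
    intro i j hij
    simp only [C]
    split_ifs <;> first | omega | simp [hAB.symm]
  have h := hM.sigma_additive C hm hd (by
    rw [hU]; exact (measure_union_le _ _).trans_lt (ENNReal.add_lt_top.2 ⟨hAv, hBv⟩))
  rw [hU] at h
  filter_upwards [h, hM.ae_empty hα] with s hs h0
  refine tendsto_nhds_unique hs ?_
  refine tendsto_const_nhds.congr' ?_
  filter_upwards [eventually_ge_atTop 2] with n hn
  obtain ⟨m, rfl⟩ := Nat.exists_eq_add_of_le hn
  rw [Finset.sum_range_add, Finset.sum_range_succ, Finset.sum_range_succ]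
  rw [Finset.sum_eq_zero (s := Finset.range m)]
  · simp [C]
  · intro i _
    have : C (2 + i) = ∅ := by simp [C, show 2 + i ≠ 1 by omega]
    rw [this]; exact h0

theorem ae_biUnion (hM : IsSymStableRandomMeasure α P M) (hα : 0 < α) {ι : Type*}
    (T : Finset ι) (A : ι → Set ℝ) (hA : ∀ i ∈ T, MeasurableSet (A i))
    (hd : (T : Set ι).PairwiseDisjoint A) (hv : ∀ i ∈ T, volume (A i) < ∞) :
    M (⋃ i ∈ T, A i) =ᵐ[P] fun s => ∑ i ∈ T, M (A i) s := by
  classical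
  induction T using Finset.induction_on with
  | empty =>
    filter_upwards [hM.ae_empty hα] with s hs
    simpa using hs
  | insert a T ha ih =>
    have h1 := ih (fun i hi => hA i (Finset.mem_insert_of_mem hi))
      (hd.subset (by simp)) (fun i hi => hv i (Finset.mem_insert_of_mem hi))
    have h2 := hM.ae_union hα (A := A a) (B := ⋃ i ∈ T, A i) (hA a (Finset.mem_insert_self _ _))
      (Finset.measurableSet_biUnion _ fun i hi => hA i (Finset.mem_insert_of_mem hi))
      (by
        rw [Set.disjoint_iUnion₂_right]
        intro i hi
        exact hd (by simp) (by simp [hi]) (by rintro rfl; exact ha hi))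
      (hv a (Finset.mem_insert_self _ _))
      ((measure_biUnion_lt_top T.finite_toSet
        fun i hi => hv i (Finset.mem_insert_of_mem hi)))
    rw [Finset.set_biUnion_insert]
    filter_upwards [h1, h2] with s hs1 hs2
    rw [hs2, hs1, Finset.sum_insert ha]

/-- The integral of `h ∘ χ` can be computed on the level sets of `χ`. -/
theorem simpleStableIntegral_map (hM : IsSymStableRandomMeasure α P M) (hα : 0 < α) {β : Type*}
    (χ : SimpleFunc ℝ β) (h : β → ℝ) (hχ : MemLp (χ.map h) (ENNReal.ofReal α) volume) :
    simpleStableIntegral M (χ.map h) =ᵐ[P]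
      fun s => ∑ b ∈ χ.range, h b * M (χ ⁻¹' {b}) s := by
  classical
  have hfin := SimpleFunc.measure_preimage_lt_top_of_memLp (by simpa using hα) (by simp) _ hχ
  have key : ∀ c ∈ (χ.map h).range, ∀ᵐ s ∂P,
      c * M ((χ.map h) ⁻¹' {c}) s = ∑ b ∈ χ.range with h b = c, h b * M (χ ⁻¹' {b}) s := by
    intro c _
    -- Additivity is available only where the level set has finite measure; for `c = 0` both sides
    -- vanish through their coefficients.
    by_cases hc : c = 0
    · filter_upwards with s
      rw [hc, zero_mul, Finset.sum_eq_zero]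
      intro b hb
      rw [(Finset.mem_filter.1 hb).2, zero_mul]
    · have hU : (χ.map h) ⁻¹' {c} = ⋃ b ∈ χ.range.filter (fun b => h b = c), χ ⁻¹' {b} := by
        ext x; simp
      have := hM.ae_biUnion hα (χ.range.filter (fun b => h b = c)) (fun b => χ ⁻¹' {b})
        (fun b _ => χ.measurableSet_preimage _)
        (fun b _ b' _ hbb' => Disjoint.preimage _ (by simpa using hbb'))
        (fun b hb => lt_of_le_of_lt (measure_mono (by
          rw [hU]; exact Set.subset_biUnion_of_mem (u := fun b => χ ⁻¹' {b}) hb)) (hfin c hc))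
      rw [← hU] at this
      filter_upwards [this] with s hs
      rw [hs, Finset.mul_sum]
      refine Finset.sum_congr rfl fun b hb => ?_
      rw [(Finset.mem_filter.1 hb).2]
  have key' := (ae_ball_iff (Finset.countable_toSet _)).2 key
  filter_upwards [key'] with s hs
  rw [simpleStableIntegral, Finset.sum_congr rfl hs, SimpleFunc.range_map]
  exact Finset.sum_fiberwise_of_maps_to (fun b hb => Finset.mem_image_of_mem _ hb) _

/-- All three functions factor through `φ.pair ψ`, so their integrals can be compared termwise on
its level sets, the common refinement. -/
theorem simpleStableIntegral_add_mul (hM : IsSymStableRandomMeasure α P M) (hα : 0 < α)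
    (φ ψ ξ : SimpleFunc ℝ ℝ) (r : ℝ) (hφ : MemLp φ (ENNReal.ofReal α) volume)
    (hψ : MemLp ψ (ENNReal.ofReal α) volume) (hξ : ∀ x, ξ x = φ x + r * ψ x) :
    simpleStableIntegral M ξ =ᵐ[P]
      fun s => simpleStableIntegral M φ s + r * simpleStableIntegral M ψ s := by
  have e : ξ = (φ.pair ψ).map (fun p => p.1 + r * p.2) := by
    ext x; simp [hξ]
  have hξ' : MemLp ((φ.pair ψ).map (fun p => p.1 + r * p.2)) (ENNReal.ofReal α) volume := by
    rw [← e]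
    exact (hφ.add (hψ.const_mul r)).ae_eq (ae_of_all _ fun x => by simp [hξ])
  have h1 := hM.simpleStableIntegral_map hα (φ.pair ψ) Prod.fst hφ
  have h2 := hM.simpleStableIntegral_map hα (φ.pair ψ) Prod.snd hψ
  have h3 := hM.simpleStableIntegral_map hα (φ.pair ψ) _ hξ'
  rw [SimpleFunc.map_fst_pair] at h1
  rw [SimpleFunc.map_snd_pair] at h2
  rw [← e] at h3
  filter_upwards [h1, h2, h3] with s h1 h2 h3
  rw [h1, h2, h3, Finset.mul_sum, ← Finset.sum_add_distrib]
  exact Finset.sum_congr rfl fun _ _ => by ring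

/-- The sets may overlap and the coefficients may coincide, so the level sets of the sum need not be
the `A i`; induction by linearity avoids describing them. -/
theorem exists_simpleFunc_sum_indicator (hM : IsSymStableRandomMeasure α P M) (hα : 0 < α)
    {ι : Type*} (T : Finset ι) (r : ι → ℝ) (A : ι → Set ℝ) (hA : ∀ i, MeasurableSet (A i))
    (hv : ∀ i, volume (A i) < ∞) :
    ∃ ψ : SimpleFunc ℝ ℝ, MemLp ψ (ENNReal.ofReal α) volume ∧
      (∀ x, ψ x = ∑ i ∈ T, r i * (A i).indicator 1 x) ∧
      simpleStableIntegral M ψ =ᵐ[P] fun s => ∑ i ∈ T, r i * M (A i) s := by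
  classical
  induction T using Finset.induction_on with
  | empty =>
    refine ⟨0, by simp, by simp, ae_of_all _ fun s => ?_⟩
    simp only [simpleStableIntegral, Finset.sum_empty]
    refine Finset.sum_eq_zero fun c hc => ?_
    have : c = 0 := by
      obtain ⟨x, hx⟩ := SimpleFunc.mem_range.1 hc
      simpa using hx.symm
    simp [this]
  | insert a T ha ih =>
    obtain ⟨ψ, hψ, hψe, hψI⟩ := ih
    let χ : SimpleFunc ℝ ℝ := SimpleFunc.piecewise (A a) (hA a) 1 0
    have hχe : ⇑χ = (A a).indicator 1 := by
      ext x; simp [χ, Set.piecewise, Set.indicator]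
    have hχ : MemLp χ (ENNReal.ofReal α) volume := by
      rw [hχe]
      exact memLp_indicator_const _ (hA a) (1 : ℝ) (Or.inr (hv a).ne)
    have hχI : simpleStableIntegral M χ =ᵐ[P] M (A a) := by
      have hpre : χ ⁻¹' {1} = A a := by
        ext x
        rw [hχe]
        by_cases hx : x ∈ A a <;> simp [hx]
      filter_upwards [hM.ae_empty hα] with s hs
      rw [simpleStableIntegral, Finset.sum_eq_single 1, one_mul, hpre]
      · intro c hc hc1
        have : c = 0 := by
          obtain ⟨x, rfl⟩ := SimpleFunc.mem_range.1 hc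
          rw [hχe] at hc1 ⊢
          by_cases hx : x ∈ A a
          · simp [hx] at hc1
          · simp [hx]
        rw [this, zero_mul]
      -- If the value `1` is not attained, then `A a` is empty.
      · intro h1
        have : χ ⁻¹' {1} = ∅ := by
          rw [SimpleFunc.preimage_eq_empty_iff]; exact h1
        rw [this, hs]; simp
    refine ⟨ψ + SimpleFunc.const ℝ (r a) * χ, ?_, ?_, ?_⟩
    · exact (hψ.add (hχ.const_mul (r a))).ae_eq (ae_of_all _ fun x => by simp)
    · intro x
      rw [Finset.sum_insert ha]
      simp [hψe, hχe, add_comm]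
    · have := hM.simpleStableIntegral_add_mul hα ψ χ (ψ + SimpleFunc.const ℝ (r a) * χ) (r a)
        hψ hχ (fun x => by simp)
      filter_upwards [this, hψI, hχI] with s h1 h2 h3
      rw [h1, h2, h3, Finset.sum_insert ha, add_comm]

theorem ae_stableIncrement (hM : IsSymStableRandomMeasure α P M) (hα : 0 < α) {ω : ℕ}
    (hω : 0 < ω) (j : ℤ) :
    stableIncrement M ω j =ᵐ[P] M (Set.Ioc ((j : ℝ) / ω) (((j : ℝ) + 1) / ω)) := by
  have hω' : (0 : ℝ) < ω := by exact_mod_cast hω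
  have hu : ∀ a b c : ℝ, a ≤ b → b ≤ c → ∀ᵐ s ∂P,
      M (Set.Ioc a c) s = M (Set.Ioc a b) s + M (Set.Ioc b c) s := by
    intro a b c hab hbc
    have := hM.ae_union hα (A := Set.Ioc a b) (B := Set.Ioc b c) measurableSet_Ioc
      measurableSet_Ioc (Set.Ioc_disjoint_Ioc_of_le le_rfl) (by simp) (by simp)
    rwa [Set.Ioc_union_Ioc_eq_Ioc hab hbc] at this
  have hle : (j : ℝ) / ω ≤ ((j : ℝ) + 1) / ω := by gcongr; linarith
  rcases le_or_gt 0 j with hj | hj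
  · have h0 : (0 : ℝ) ≤ (j : ℝ) / ω := div_nonneg (by exact_mod_cast hj) hω'.le
    filter_upwards [hu 0 _ _ h0 hle] with s hs
    simp only [stableIncrement, stableLevyMotion, h0, h0.trans hle, if_true]
    rw [hs]; ring
  · have h0 : (j : ℝ) / ω < 0 := div_neg_of_neg_of_pos (by exact_mod_cast hj) hω'
    have h1 : ((j : ℝ) + 1) / ω ≤ 0 :=
      div_nonpos_of_nonpos_of_nonneg (by exact_mod_cast hj) hω'.le
    filter_upwards [hu _ _ _ hle h1, hM.ae_empty hα] with s hs he
    simp only [stableIncrement, stableLevyMotion, not_le.2 h0, if_false]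
    -- The right endpoint may be exactly `0`, which falls under the other branch of
    -- `stableLevyMotion`; there the value is `M ∅`.
    split_ifs with h
    · have h2 : ((j : ℝ) + 1) / ω = 0 := le_antisymm h1 h
      rw [hs, h2]
      simp [he]
    · rw [hs]; ring

end IsSymStableRandomMeasure

/-! ### The `L^α` quasi-norm. -/

theorem eLpNorm_ofReal_rpow {X : Type*} [MeasurableSpace X] {μ : Measure X} {α : ℝ} (hα : 0 < α)
    (f : X → ℝ) : eLpNorm f (ENNReal.ofReal α) μ ^ α = ∫⁻ x, ‖f x‖ₑ ^ α ∂μ := by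
  rw [eLpNorm_eq_lintegral_rpow_enorm_toReal (by simpa using hα) (by simp),
    ENNReal.toReal_ofReal hα.le, ← ENNReal.rpow_mul, one_div_mul_cancel hα.ne', ENNReal.rpow_one]

/-- Minkowski's inequality for `α ≥ 1`; for `α ≤ 1` the pointwise bound `(x + y)^α ≤ x^α + y^α`,
integrated. It treats both ranges of `α` uniformly. -/
theorem eLpNorm_add_rpow_min_le {X : Type*} [MeasurableSpace X] {μ : Measure X} {α : ℝ}
    (hα : 0 < α) {f g : X → ℝ} (hf : AEStronglyMeasurable f μ) (hg : AEStronglyMeasurable g μ) :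
    eLpNorm (f + g) (ENNReal.ofReal α) μ ^ min 1 α ≤
      eLpNorm f (ENNReal.ofReal α) μ ^ min 1 α + eLpNorm g (ENNReal.ofReal α) μ ^ min 1 α := by
  rcases le_total 1 α with h | h
  · rw [min_eq_left h]
    simp only [ENNReal.rpow_one]
    exact eLpNorm_add_le hf hg (by simpa using h)
  · rw [min_eq_right h]
    simp only [eLpNorm_ofReal_rpow hα]
    rw [← lintegral_add_left' (hf.enorm.pow_const α)]
    refine lintegral_mono fun x => ?_
    calc ‖(f + g) x‖ₑ ^ α ≤ (‖f x‖ₑ + ‖g x‖ₑ) ^ α := by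
          gcongr; exact enorm_add_le _ _
      _ ≤ _ := ENNReal.rpow_add_le_add_rpow _ _ hα.le h

/-- The `L^α` quasi-norm is continuous, also for `α < 1`. -/
theorem tendsto_eLpNorm_of_tendsto_eLpNorm_sub {X : Type*} [MeasurableSpace X] {μ : Measure X}
    {α : ℝ} (hα : 0 < α) {f : X → ℝ} {φ : ℕ → X → ℝ} (hf : MemLp f (ENNReal.ofReal α) μ)
    (hφ : ∀ n, AEStronglyMeasurable (φ n) μ)
    (h : Tendsto (fun n => eLpNorm (fun x => f x - φ n x) (ENNReal.ofReal α) μ) atTop (𝓝 0)) :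
    Tendsto (fun n => eLpNorm (φ n) (ENNReal.ofReal α) μ) atTop
      (𝓝 (eLpNorm f (ENNReal.ofReal α) μ)) := by
  set q := min 1 α with hq
  have hq0 : 0 < q := lt_min one_pos hα
  let N : (X → ℝ) → ℝ≥0∞ := fun u => eLpNorm u (ENNReal.ofReal α) μ ^ q
  have hN : Tendsto (fun n => N (fun x => f x - φ n x)) atTop (𝓝 0) := by
    have := (ENNReal.continuous_rpow_const (y := q)).tendsto 0 |>.comp h
    rwa [ENNReal.zero_rpow_of_pos hq0] at this
  have hNf : N f ≠ ∞ := ENNReal.rpow_ne_top_of_nonneg hq0.le hf.eLpNorm_ne_top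
  have key : Tendsto (fun n => N (φ n)) atTop (𝓝 (N f)) := by
    -- Reverse and direct triangle inequalities for `N`; the lower bound converges to `N f` because
    -- `N f` is finite.
    refine tendsto_of_tendsto_of_tendsto_of_le_of_le
      (g := fun n => N f - N (fun x => f x - φ n x))
      (h := fun n => N f + N (fun x => f x - φ n x)) ?_ ?_ ?_ ?_
    · simpa using ENNReal.Tendsto.sub tendsto_const_nhds hN (Or.inl hNf)
    · simpa using Tendsto.add (tendsto_const_nhds (x := N f)) hN
    · intro n
      simp only [tsub_le_iff_right]
      have := eLpNorm_add_rpow_min_le hα (hφ n) (hf.1.sub (hφ n))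
      rwa [add_sub_cancel] at this
    · intro n
      have := eLpNorm_add_rpow_min_le hα hf.1 ((hφ n).sub hf.1)
      rw [add_sub_cancel, eLpNorm_sub_comm] at this
      exact this
  have := (ENNReal.continuous_rpow_const (y := q⁻¹)).tendsto (N f) |>.comp key
  simpa [N, Function.comp_def, ← ENNReal.rpow_mul, mul_inv_cancel₀ hq0.ne'] using this

/-! ### Tail bounds and limits of symmetric stable laws. -/

namespace HasSymStableLaw

variable {S : Type*} [MeasurableSpace S] {α σ : ℝ} {P : Measure S} [IsProbabilityMeasure P]
  {X : S → ℝ}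

/-- The tail of a law is controlled by the mean of `1 - charFun` near `0`, and here `1 - exp (-x) ≤
x`. A small scale thus forces a variable close to `0` in probability. -/
theorem measureReal_lt_abs_le (hα : 0 < α) (h : HasSymStableLaw α σ P X) {ε : ℝ} (hε : 0 < ε) :
    P.real {s | ε < |X s|} ≤ 2 * (σ * (2 * ε⁻¹)) ^ α := by
  have := Measure.isProbabilityMeasure_map h.aemeasurable
  have h1 := measureReal_abs_gt_le_integral_charFun (μ := P.map X) hε
  have h2 : (P.map X).real {x | ε < |x|} = P.real {s | ε < |X s|} :=
    map_measureReal_apply_of_aemeasurable h.aemeasurable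
      (measurableSet_lt measurable_const measurable_norm)
  rw [h2] at h1
  refine h1.trans ?_
  have h3 : ‖∫ t in (-2 * ε⁻¹)..(2 * ε⁻¹), 1 - charFun (P.map X) t‖ ≤
      (σ * (2 * ε⁻¹)) ^ α * |2 * ε⁻¹ - -2 * ε⁻¹| := by
    refine intervalIntegral.norm_integral_le_of_norm_le_const fun t ht => ?_
    rw [Set.uIoc_of_le (by nlinarith [inv_pos.2 hε])] at ht
    have ht' : |t| ≤ 2 * ε⁻¹ := abs_le.2 ⟨by linarith [ht.1], ht.2⟩
    rw [h.charFun_eq, ← Complex.ofReal_one, ← Complex.ofReal_sub, Complex.norm_real,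
      Real.norm_eq_abs, Real.mul_rpow h.scale_nonneg (by positivity)]
    have hx : 0 ≤ σ ^ α * |t| ^ α := by
      have := h.scale_nonneg
      positivity
    rw [abs_of_nonneg (by simpa using hx)]
    have h4 : σ ^ α * |t| ^ α ≤ σ ^ α * (2 * ε⁻¹) ^ α := by
      have := h.scale_nonneg
      gcongr
    linarith [Real.add_one_le_exp (-(σ ^ α * |t| ^ α))]
  have h5 : |2 * ε⁻¹ - -2 * ε⁻¹| = 4 * ε⁻¹ := by
    rw [abs_of_nonneg] <;> [ring; (have := inv_pos.2 hε; linarith)]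
  rw [h5] at h3
  calc _ ≤ 2⁻¹ * ε * ((σ * (2 * ε⁻¹)) ^ α * (4 * ε⁻¹)) := by gcongr
    _ = _ := by field_simp; ring

/-- Symmetric stable laws are closed under limits in probability with convergent scales. -/
theorem of_tendstoInMeasure (hα : 0 < α) {Y : ℕ → S → ℝ} {τ : ℕ → ℝ}
    (hY : ∀ n, HasSymStableLaw α (τ n) P (Y n)) (hX : AEMeasurable X P)
    (hYX : TendstoInMeasure P Y atTop X) (hτ : Tendsto τ atTop (𝓝 σ)) :
    HasSymStableLaw α σ P X where
  aemeasurable := hX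
  scale_nonneg := ge_of_tendsto' hτ fun n => (hY n).scale_nonneg
  charFun_eq t := by
    -- Along an almost surely convergent subsequence, dominated convergence gives convergence of the
    -- characteristic functions.
    obtain ⟨ns, hns, hae⟩ := hYX.exists_seq_tendsto_ae
    have e : ∀ {Z : S → ℝ}, AEMeasurable Z P →
        charFun (P.map Z) t = ∫ s, Complex.exp (t * Z s * Complex.I) ∂P := by
      intro Z hZ
      rw [charFun_apply_real, integral_map hZ (by fun_prop)]
    have h1 : Tendsto (fun n => charFun (P.map (Y (ns n))) t) atTop
        (𝓝 (charFun (P.map X) t)) := by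
      rw [e hX]
      simp_rw [fun n => e (hY (ns n)).aemeasurable]
      refine tendsto_integral_of_dominated_convergence (fun _ => 1) (fun n => ?_)
        (integrable_const _) (fun n => ae_of_all _ fun s => ?_) ?_
      · have := (hY (ns n)).aemeasurable
        exact AEMeasurable.aestronglyMeasurable (by fun_prop)
      · rw [← Complex.ofReal_mul, Complex.norm_exp_ofReal_mul_I]
      · filter_upwards [hae] with s hs
        have hc : Continuous fun x : ℝ => Complex.exp (t * x * Complex.I) := by fun_prop
        exact (hc.tendsto _).comp hs
    have h2 : Tendsto (fun n => charFun (P.map (Y (ns n))) t) atTop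
        (𝓝 ((Real.exp (-(σ ^ α * |t| ^ α)) : ℝ) : ℂ)) := by
      simp_rw [fun n => (hY (ns n)).charFun_eq t]
      have hc : Continuous fun x : ℝ => ((Real.exp (-(x ^ α * |t| ^ α)) : ℝ) : ℂ) := by
        have := Real.continuous_rpow_const hα.le
        fun_prop
      exact (hc.tendsto σ).comp (hτ.comp hns.tendsto_atTop)
    exact tendsto_nhds_unique h1 h2

end HasSymStableLaw

/-! ### Existence, law and linearity of the stable integral. -/

namespace IsSymStableRandomMeasure

variable {S : Type*} [MeasurableSpace S] {P : Measure S} [IsProbabilityMeasure P] {α : ℝ}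
  {M : Set ℝ → S → ℝ} {f : ℝ → ℝ} {X : S → ℝ}

theorem ae_simpleStableIntegral_sub (hM : IsSymStableRandomMeasure α P M) (hα : 0 < α)
    (φ ψ : SimpleFunc ℝ ℝ) (hφ : MemLp φ (ENNReal.ofReal α) volume)
    (hψ : MemLp ψ (ENNReal.ofReal α) volume) :
    simpleStableIntegral M (φ - ψ) =ᵐ[P]
      fun s => simpleStableIntegral M φ s - simpleStableIntegral M ψ s := by
  filter_upwards [hM.simpleStableIntegral_add_mul hα φ ψ (φ - ψ) (-1) hφ hψ
    (fun x => by simp; ring)] with s hs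
  rw [hs]; ring

/-- Simple approximants chosen to converge fast enough have integrals whose successive differences
are summable almost surely, by the tail bound and Borel–Cantelli; the limit is the integral. -/
theorem exists_isStableIntegral (hM : IsSymStableRandomMeasure α P M) (hα : 0 < α)
    (hf : MemLp f (ENNReal.ofReal α) volume) : ∃ X, IsStableIntegral α P M f X := by
  have hp : ENNReal.ofReal α ≠ ∞ := ENNReal.ofReal_ne_top
  -- Small `L^α` norm makes a large integral improbable.
  have tail : ∀ n : ℕ, ∃ ρ : ℝ≥0∞, ρ ≠ 0 ∧ ∀ φ : SimpleFunc ℝ ℝ,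
      MemLp φ (ENNReal.ofReal α) volume → eLpNorm φ (ENNReal.ofReal α) volume < ρ →
      P {s | (1 / 2 : ℝ) ^ n < |simpleStableIntegral M φ s|} ≤ ENNReal.ofReal ((1 / 2) ^ n) := by
    intro n
    have hc : Tendsto (fun x : ℝ => 2 * (x * (2 * ((1 / 2 : ℝ) ^ n)⁻¹)) ^ α) (𝓝 0) (𝓝 0) := by
      have hc : Continuous (fun x : ℝ => 2 * (x * (2 * ((1 / 2 : ℝ) ^ n)⁻¹)) ^ α) := by
        have := Real.continuous_rpow_const hα.le
        fun_prop
      simpa [hα.ne'] using hc.tendsto 0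
    obtain ⟨δ, hδ, h⟩ := Metric.eventually_nhds_iff.1
      (hc.eventually (gt_mem_nhds (show (0 : ℝ) < (1 / 2) ^ n by positivity)))
    refine ⟨ENNReal.ofReal δ, by simpa using hδ, fun φ hφ hlt => ?_⟩
    have hσ : (eLpNorm φ (ENNReal.ofReal α) volume).toReal < δ := by
      rwa [← ENNReal.lt_ofReal_iff_toReal_lt hφ.eLpNorm_ne_top]
    have h1 := (hM.hasSymStableLaw_simpleStableIntegral hα φ hφ).measureReal_lt_abs_le hα
      (show (0 : ℝ) < (1 / 2) ^ n by positivity)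
    rw [← ofReal_measureReal]
    refine ENNReal.ofReal_le_ofReal (h1.trans (h ?_).le)
    rwa [dist_zero_right, Real.norm_of_nonneg ENNReal.toReal_nonneg]
  choose ρ hρ0 hρ using tail
  -- Two functions of quasi-norm at most `η n` have a sum of quasi-norm below `ρ n`. This replaces
  -- the triangle inequality, which fails for `α < 1`.
  choose η hη0 hη using fun n => exists_Lp_half ℝ (volume : Measure ℝ) (ENNReal.ofReal α) (hρ0 n)
  have happ : ∀ n : ℕ, ∃ φ : SimpleFunc ℝ ℝ,
      eLpNorm (f - ⇑φ) (ENNReal.ofReal α) volume < ((n : ℝ≥0∞) + 1)⁻¹ ∧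
      MemLp φ (ENNReal.ofReal α) volume := fun n =>
    hf.exists_simpleFunc_eLpNorm_sub_lt hp (by simp)
  choose ψ hψ hψm using happ
  have hψ0 : Tendsto (fun n => eLpNorm (f - ⇑(ψ n)) (ENNReal.ofReal α) volume) atTop (𝓝 0) := by
    refine tendsto_of_tendsto_of_tendsto_of_le_of_le tendsto_const_nhds
      (ENNReal.tendsto_inv_nat_nhds_zero.comp (tendsto_add_atTop_nat 1)) (fun n => zero_le)
      (fun n => ?_)
    simpa using (hψ n).le
  obtain ⟨e, he, hee⟩ := extraction_forall_of_eventually'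
    (P := fun n k => ∀ m ≥ k, eLpNorm (f - ⇑(ψ m)) (ENNReal.ofReal α) volume ≤ η n)
    (fun n => by
      obtain ⟨k, hk⟩ := eventually_atTop.1
        (hψ0.eventually (ge_mem_nhds (hη0 n)))
      exact ⟨k, fun l hl m hm => hk m (hl.trans hm)⟩)
  let I : ℕ → S → ℝ := fun n => simpleStableIntegral M (ψ (e n))
  have hIm : ∀ n, Measurable (I n) := fun n =>
    hM.measurable_simpleStableIntegral hα _ (hψm _)
  have hsmall : ∀ n, P {s | (1 / 2 : ℝ) ^ n < |I (n + 1) s - I n s|} ≤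
      ENNReal.ofReal ((1 / 2) ^ n) := by
    intro n
    have h1 : eLpNorm (ψ (e (n + 1)) - ψ (e n) : SimpleFunc ℝ ℝ) (ENNReal.ofReal α) volume
        < ρ n := by
      have h2 := hη n (f - ψ (e n)) (ψ (e (n + 1)) - f) (hf.1.sub (hψm _).1)
        ((hψm _).1.sub hf.1) (hee n _ le_rfl)
        (by rw [eLpNorm_sub_comm]; exact hee n _ (he.monotone n.le_succ))
      rwa [add_comm, sub_add_sub_cancel] at h2
    have h3 := hρ n _ ((hψm _).sub (hψm _)) h1
    refine le_trans (measure_mono_ae ?_) h3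
    filter_upwards [hM.ae_simpleStableIntegral_sub hα _ _ (hψm (e (n + 1))) (hψm (e n))]
      with s hs
    intro h
    change (1 / 2 : ℝ) ^ n < _
    rw [hs]
    exact h
  have hbc := ae_eventually_notMem (μ := P)
    (s := fun n => {s | (1 / 2 : ℝ) ^ n < |I (n + 1) s - I n s|}) (by
      refine ne_top_of_le_ne_top ?_ (ENNReal.tsum_le_tsum hsmall)
      rw [← ENNReal.ofReal_tsum_of_nonneg (fun n => by positivity) summable_geometric_two]
      exact ENNReal.ofReal_ne_top)
  have hlim : ∀ᵐ s ∂P, ∃ x, Tendsto (fun n => I n s) atTop (𝓝 x) := by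
    filter_upwards [hbc] with s hs
    obtain ⟨N, hN⟩ := eventually_atTop.1 hs
    have hcs : CauchySeq fun n => I (n + N) s := by
      refine cauchySeq_of_le_geometric (1 / 2) 1 (by norm_num) fun n => ?_
      have h1 := hN (n + N) (Nat.le_add_left _ _)
      simp only [not_lt] at h1
      rw [dist_comm, Real.dist_eq, one_mul, show n + 1 + N = n + N + 1 by ring]
      exact h1.trans (pow_le_pow_of_le_one (by norm_num) (by norm_num) (Nat.le_add_right _ _))
    obtain ⟨x, hx⟩ := cauchySeq_tendsto_of_complete hcs
    exact ⟨x, (tendsto_add_atTop_iff_nat N).1 hx⟩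
  obtain ⟨X, hX, hIX⟩ := measurable_limit_of_tendsto_metrizable_ae
    (fun n => (hIm n).aemeasurable) hlim
  exact ⟨X, hX, fun n => ψ (e n), fun n => hψm _, hψ0.comp he.tendsto_atTop,
    tendstoInMeasure_of_tendsto_ae (fun n => (hIm n).aestronglyMeasurable) hIX⟩

theorem hasSymStableLaw_of_isStableIntegral (hM : IsSymStableRandomMeasure α P M) (hα : 0 < α)
    (hf : MemLp f (ENNReal.ofReal α) volume) (hX : IsStableIntegral α P M f X) :
    HasSymStableLaw α (eLpNorm f (ENNReal.ofReal α) volume).toReal P X := by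
  obtain ⟨hXm, φ, hφ, hφf, hφX⟩ := hX
  refine HasSymStableLaw.of_tendstoInMeasure hα
    (fun n => hM.hasSymStableLaw_simpleStableIntegral hα (φ n) (hφ n)) hXm.aemeasurable hφX ?_
  exact (ENNReal.tendsto_toReal hf.eLpNorm_ne_top).comp
    (tendsto_eLpNorm_of_tendsto_eLpNorm_sub hα hf (fun n => (hφ n).1) hφf)

/-- The approximants `φ n - ψ` serve for the difference. Hence the approximation error is itself a
stable integral, and no joint law is needed. -/
theorem isStableIntegral_sub_simpleFunc (hM : IsSymStableRandomMeasure α P M) (hα : 0 < α)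
    (hX : IsStableIntegral α P M f X) (ψ : SimpleFunc ℝ ℝ)
    (hψ : MemLp ψ (ENNReal.ofReal α) volume) :
    IsStableIntegral α P M (fun x => f x - ψ x) (fun s => X s - simpleStableIntegral M ψ s) := by
  obtain ⟨hXm, φ, hφ, hφf, hφX⟩ := hX
  refine ⟨hXm.sub (hM.measurable_simpleStableIntegral hα ψ hψ), fun n => φ n - ψ,
    fun n => (hφ n).sub hψ, ?_, ?_⟩
  · refine hφf.congr fun n => ?_
    congr 1
    ext x
    simp
  · have h : TendstoInMeasure P (fun n s => simpleStableIntegral M (φ n) s -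
        simpleStableIntegral M ψ s) atTop (fun s => X s - simpleStableIntegral M ψ s) := by
      intro ε hε
      simpa only [edist_sub_right] using hφX ε hε
    exact h.congr_left fun n => (hM.ae_simpleStableIntegral_sub hα _ _ (hφ n) hψ).symm

/-- Existence rules out the default value `0` in `stableIntegral`. -/
theorem isStableIntegral_stableIntegral (hM : IsSymStableRandomMeasure α P M) (hα : 0 < α)
    (hf : MemLp f (ENNReal.ofReal α) volume) :
    IsStableIntegral α P M f (stableIntegral α P M f) := by
  have h := hM.exists_isStableIntegral hα hf
  rw [stableIntegral, dif_pos h]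
  exact h.choose_spec

end IsSymStableRandomMeasure

/-! ### The `L^α` error of the step function, cell by cell. -/

theorem setLIntegral_Ico_abs_sub_rpow {x δ p u K : ℝ} (hδ : 0 ≤ δ) (hp : 0 < p) (hK : 0 ≤ K)
    (hu : u = x ∨ u = x + δ) :
    ∫⁻ s in Set.Ico x (x + δ), ENNReal.ofReal (K * |s - u| ^ p) =
      ENNReal.ofReal (K * (δ ^ (p + 1) / (p + 1))) := by
  have hcont : Continuous fun s : ℝ => K * |s - u| ^ p := by
    have := Real.continuous_rpow_const hp.le
    fun_prop
  have hint : IntegrableOn (fun s : ℝ => K * |s - u| ^ p) (Set.Ico x (x + δ)) :=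
    (hcont.continuousOn.integrableOn_Icc).mono_set Set.Ico_subset_Icc_self
  rw [← ofReal_integral_eq_lintegral_ofReal hint (ae_of_all _ fun s => by positivity),
    integral_Ico_eq_integral_Ioo, ← integral_Ioc_eq_integral_Ioo,
    ← intervalIntegral.integral_of_le (by linarith), intervalIntegral.integral_const_mul]
  have h0 : ∫ s in (0 : ℝ)..δ, |s| ^ p = δ ^ (p + 1) / (p + 1) := by
    rw [intervalIntegral.integral_congr (g := fun s => s ^ p), integral_rpow (Or.inl (by linarith)),
      Real.zero_rpow (by linarith), sub_zero]
    intro s hs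
    rw [Set.uIcc_of_le hδ] at hs
    simp only [abs_of_nonneg hs.1]
  rcases hu with rfl | rfl
  · rw [intervalIntegral.integral_comp_sub_right (fun s => |s| ^ p)]
    simp [h0]
  · simp_rw [abs_sub_comm _ (x + δ)]
    rw [intervalIntegral.integral_comp_sub_left (fun s => |s| ^ p)]
    simp [h0]

/-- The contribution of one cell of the Riemann sum to the approximation error. -/
theorem setLIntegral_Ico_sub_const_le {g : ℝ → ℝ} {α γ a c η : ℝ} (hα : 0 < α) (ha : 0 < a)
    (hc : 0 < c)
    (hinc : ∀ u h : ℝ, u ≠ 0 → |h| < η → |g (u + h) - g u| ≤ c * |h| ^ a * |u| ^ (γ - a))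
    {ω m : ℕ} (hω : 1 / (ω : ℝ) < η) (hω0 : 0 < ω) (hm : 0 < m) {x u : ℝ}
    (hu : u = x ∨ u = x + 1 / ω) (hum : |u| = m / ω) :
    ∫⁻ s in Set.Ico x (x + 1 / ω), ‖g s - g u‖ₑ ^ α ≤
      ENNReal.ofReal (c ^ α / ((1 + a * α) * (ω : ℝ) ^ (1 + γ * α)) *
        (1 / (m : ℝ) ^ ((a - γ) * α))) := by
  have hω' : (0 : ℝ) < ω := by exact_mod_cast hω0
  have hm' : (0 : ℝ) < m := by exact_mod_cast hm
  have hu0 : u ≠ 0 := by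
    rw [← abs_pos, hum]; positivity
  calc ∫⁻ s in Set.Ico x (x + 1 / ω), ‖g s - g u‖ₑ ^ α
      ≤ ∫⁻ s in Set.Ico x (x + 1 / ω),
          ENNReal.ofReal (c ^ α * |u| ^ ((γ - a) * α) * |s - u| ^ (a * α)) := by
        refine setLIntegral_mono' measurableSet_Ico fun s hs => ?_
        have hsu : |s - u| ≤ 1 / ω := by
          rw [abs_le]
          rcases hu with rfl | rfl <;> constructor <;> linarith [hs.1, hs.2]
        have h := hinc u (s - u) hu0 (hsu.trans_lt hω)
        rw [add_sub_cancel] at h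
        rw [← ofReal_norm, ENNReal.ofReal_rpow_of_nonneg (norm_nonneg _) hα.le]
        refine ENNReal.ofReal_le_ofReal ?_
        calc ‖g s - g u‖ ^ α ≤ (c * |s - u| ^ a * |u| ^ (γ - a)) ^ α := by
              gcongr; exact h
          _ = _ := by
              rw [Real.mul_rpow (by positivity) (by positivity),
                Real.mul_rpow (by positivity) (by positivity), ← Real.rpow_mul (abs_nonneg _),
                ← Real.rpow_mul (abs_nonneg _)]
              ring
    _ = ENNReal.ofReal (c ^ α * |u| ^ ((γ - a) * α) *
          ((1 / (ω : ℝ)) ^ (a * α + 1) / (a * α + 1))) :=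
        setLIntegral_Ico_abs_sub_rpow (by positivity) (by positivity) (by positivity) hu
    _ ≤ _ := by
        refine ENNReal.ofReal_le_ofReal (le_of_eq ?_)
        rw [hum, Real.div_rpow hm'.le hω'.le, Real.div_rpow zero_le_one hω'.le, Real.one_rpow,
          show (γ - a) * α = -((a - γ) * α) by ring, Real.rpow_neg hm'.le, Real.rpow_neg hω'.le]
        -- The factor `ω^((a-γ)α)` coming from `|u| = m/ω` cancels against part of `ω^(aα+1)`,
        -- leaving `ω^(1+γα)`.
        have e : (ω : ℝ) ^ (a * α + 1) = ω ^ (1 + γ * α) * ω ^ ((a - γ) * α) := by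
          rw [← Real.rpow_add hω']; congr 1; ring
        rw [e]
        have := mul_pos ha hα
        field_simp
        ring

theorem sum_Icc_neg_add_one {β : Type*} [AddCommMonoid β] {n : ℤ} (hn : 0 ≤ n) (f : ℤ → β) :
    ∑ j ∈ Finset.Icc (-n + 1) n, f j =
      (∑ j ∈ Finset.Icc (-n + 1) 0, f j) + ∑ j ∈ Finset.Icc 1 n, f j := by
  rw [← Finset.sum_union]
  · congr 1
    ext j
    simp only [Finset.mem_union, Finset.mem_Icc]
    omega
  · rw [Finset.disjoint_left]
    intro j h1 h2
    rw [Finset.mem_Icc] at h1 h2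
    omega

theorem mem_Ico_cell_iff {ω : ℕ} (hω : 0 < ω) (j : ℤ) (s : ℝ) :
    s ∈ Set.Ico (((j : ℝ) - 1) / ω) ((j : ℝ) / ω) ↔ ⌊(ω : ℝ) * s⌋ + 1 = j := by
  have hω' : (0 : ℝ) < ω := by exact_mod_cast hω
  rw [← eq_sub_iff_add_eq, Int.floor_eq_iff, Set.mem_Ico, div_le_iff₀ hω', lt_div_iff₀ hω',
    mul_comm s]
  push_cast
  rw [sub_add_cancel]

theorem lintegral_step_error_le {g : ℝ → ℝ} {α γ a c η : ℝ} (hα : 0 < α) (ha : 0 < a)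
    (hc : 0 < c) (hg : MemLp g (ENNReal.ofReal α) volume)
    (hinc : ∀ u h : ℝ, u ≠ 0 → |h| < η → |g (u + h) - g u| ≤ c * |h| ^ a * |u| ^ (γ - a))
    {ω : ℕ} (hω : 1 / (ω : ℝ) < η) (hω0 : 0 < ω) (Ω : ℕ) (r : ℤ → ℝ)
    (hr : ∀ j ≤ 0, r j = g (((j : ℝ) - 1) / ω)) (hr' : ∀ j > 0, r j = g ((j : ℝ) / ω)) :
    ∫⁻ s, ‖g s - ∑ j ∈ Finset.Icc (-((ω : ℤ) * Ω) + 1) ((ω : ℤ) * Ω),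
        r j * (Set.Ico (((j : ℝ) - 1) / ω) ((j : ℝ) / ω)).indicator 1 s‖ₑ ^ α ≤
      ENNReal.ofReal (errorBound α g γ a c ω Ω) := by
  classical
  have hω' : (0 : ℝ) < ω := by exact_mod_cast hω0
  set J := Finset.Icc (-((ω : ℤ) * Ω) + 1) ((ω : ℤ) * Ω) with hJ
  let cell : ℤ → Set ℝ := fun j => Set.Ico (((j : ℝ) - 1) / ω) ((j : ℝ) / ω)
  -- The point `s` lies in the single cell with index `⌊ωs⌋ + 1`, so at most one term survives.
  have hsum : ∀ s, ∑ j ∈ J, r j * (cell j).indicator 1 s =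
      if ⌊(ω : ℝ) * s⌋ + 1 ∈ J then r (⌊(ω : ℝ) * s⌋ + 1) else 0 := by
    intro s
    rw [← Finset.sum_ite_eq J (⌊(ω : ℝ) * s⌋ + 1) r]
    refine Finset.sum_congr rfl fun j _ => ?_
    by_cases h : ⌊(ω : ℝ) * s⌋ + 1 = j
    · rw [if_pos h, Set.indicator_of_mem ((mem_Ico_cell_iff hω0 j s).2 h)]; simp
    · rw [if_neg h, Set.indicator_of_notMem (fun h' => h ((mem_Ico_cell_iff hω0 j s).1 h'))]
      simp
  have hmem : ∀ s : ℝ, ⌊(ω : ℝ) * s⌋ + 1 ∈ J ↔ s ∈ Set.Ico (-(Ω : ℝ)) Ω := by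
    intro s
    rw [hJ, Finset.mem_Icc, add_le_add_iff_right, Int.le_floor, Int.add_one_le_iff, Int.floor_lt,
      Set.mem_Ico]
    push_cast
    rw [← mul_neg, mul_le_mul_iff_right₀ hω', mul_lt_mul_iff_right₀ hω']
  set B : ℕ → ℝ := fun m => c ^ α / ((1 + a * α) * (ω : ℝ) ^ (1 + γ * α)) *
    (1 / (m : ℝ) ^ ((a - γ) * α)) with hB
  have hB0 : ∀ m, 0 ≤ B m := fun m => by
    have := mul_pos ha hα
    positivity
  have hcell_eq : ∀ j : ℤ, cell j = Set.Ico (((j : ℝ) - 1) / ω) (((j : ℝ) - 1) / ω + 1 / ω) := by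
    intro j
    simp only [cell]
    congr 1
    field_simp
    ring
  set F : ℝ → ℝ≥0∞ := fun s => ‖g s - ∑ j ∈ J, r j * (cell j).indicator 1 s‖ₑ ^ α with hF
  have hFcell : ∀ j ∈ J, ∫⁻ s in cell j, F s = ∫⁻ s in cell j, ‖g s - r j‖ₑ ^ α := by
    intro j hj
    refine setLIntegral_congr_fun measurableSet_Ico fun s hs => ?_
    simp only [hF, hsum, (mem_Ico_cell_iff hω0 j s).1 hs, hj, if_true]
  have hneg : ∑ j ∈ Finset.Icc (-((ω : ℤ) * Ω) + 1) 0, ∫⁻ s in cell j, F s ≤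
      ENNReal.ofReal (∑ m ∈ Finset.Icc 1 (ω * Ω), B m) := by
    rw [ENNReal.ofReal_sum_of_nonneg fun m _ => hB0 m]
    -- For `j ≤ 0` the node is the left endpoint `(j - 1)/ω`, at distance `m/ω` from `0` with `m = 1
    -- - j`.
    rw [← Finset.sum_nbij' (s := Finset.Icc (-((ω : ℤ) * Ω) + 1) 0)
      (f := fun j => ENNReal.ofReal (B (1 - j).toNat)) (fun j => (1 - j).toNat)
      (fun m => 1 - (m : ℤ))]
    · refine Finset.sum_le_sum fun j hj => ?_
      rw [Finset.mem_Icc] at hj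
      rw [hFcell j (Finset.mem_Icc.2 ⟨hj.1, hj.2.trans (by positivity)⟩), hr j hj.2, hcell_eq]
      refine setLIntegral_Ico_sub_const_le hα ha hc hinc hω hω0 (by omega) (Or.inl rfl) ?_
      have h1 : (((1 - j).toNat : ℕ) : ℝ) = 1 - j := by
        have : (((1 - j).toNat : ℕ) : ℤ) = 1 - j := Int.toNat_of_nonneg (by omega)
        exact_mod_cast this
      have h2 : (j : ℝ) ≤ 0 := by exact_mod_cast hj.2
      rw [h1, abs_div, abs_of_pos hω', abs_of_neg (by linarith), neg_sub]
    · intro j hj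
      simp only [Finset.mem_Icc] at hj ⊢
      zify
      omega
    · intro m hm
      simp only [Finset.mem_Icc] at hm ⊢
      zify at hm
      omega
    · intro j hj
      simp only [Finset.mem_Icc] at hj
      omega
    · intro m hm
      omega
    · intro j _
      rfl
  have hpos : ∑ j ∈ Finset.Icc (1 : ℤ) ((ω : ℤ) * Ω), ∫⁻ s in cell j, F s ≤
      ENNReal.ofReal (∑ m ∈ Finset.Icc 1 (ω * Ω), B m) := by
    rw [ENNReal.ofReal_sum_of_nonneg fun m _ => hB0 m]
    -- For `j ≥ 1` the node is the right endpoint `j/ω`, so `m = j`.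
    rw [← Finset.sum_nbij' (s := Finset.Icc (1 : ℤ) ((ω : ℤ) * Ω))
      (f := fun j => ENNReal.ofReal (B j.toNat)) (fun j => j.toNat) (fun m => (m : ℤ))]
    · refine Finset.sum_le_sum fun j hj => ?_
      rw [Finset.mem_Icc] at hj
      rw [hFcell j (Finset.mem_Icc.2 ⟨le_trans (by
        have : (0 : ℤ) ≤ (ω : ℤ) * Ω := by positivity
        omega) hj.1, hj.2⟩), hr' j (by omega), hcell_eq]
      refine setLIntegral_Ico_sub_const_le hα ha hc hinc hω hω0 (by omega)
        (Or.inr (by field_simp; ring)) ?_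
      have h1 : ((j.toNat : ℕ) : ℝ) = j := by
        have : ((j.toNat : ℕ) : ℤ) = j := Int.toNat_of_nonneg (by omega)
        exact_mod_cast this
      have h2 : (0 : ℝ) < j := by exact_mod_cast (show 0 < j by omega)
      rw [h1, abs_of_pos (by positivity)]
    · intro j hj
      simp only [Finset.mem_Icc] at hj ⊢
      zify
      omega
    · intro m hm
      simp only [Finset.mem_Icc] at hm ⊢
      zify at hm
      exact hm
    · intro j hj
      simp only [Finset.mem_Icc] at hj
      omega
    · intro m hm
      omega
    · intro j _
      rfl
  have hcells : ∑ j ∈ J, ∫⁻ s in cell j, F s ≤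
      ENNReal.ofReal (2 * ∑ m ∈ Finset.Icc 1 (ω * Ω), B m) := by
    have hB1 := Finset.sum_nonneg (s := Finset.Icc 1 (ω * Ω)) fun m _ => hB0 m
    rw [hJ, sum_Icc_neg_add_one (by positivity), two_mul, ENNReal.ofReal_add hB1 hB1]
    exact add_le_add hneg hpos
  have hgint : Integrable (fun s => |g s| ^ α) volume := by
    have := hg.integrable_norm_rpow (by simpa using hα) (by simp)
    simpa [ENNReal.toReal_ofReal hα.le] using this
  have hout : ∀ D D' : Set ℝ, MeasurableSet D → D ⊆ D' →
      (∀ s ∈ D, s ∉ Set.Ico (-(Ω : ℝ)) Ω) →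
      ∫⁻ s in D, F s ≤ ENNReal.ofReal (∫ s in D', |g s| ^ α) := by
    intro D D' hD hDD' hs
    rw [ofReal_integral_eq_lintegral_ofReal hgint.integrableOn
      (ae_of_all _ fun s => by positivity)]
    refine le_trans (setLIntegral_mono' hD fun s hsD => ?_) (lintegral_mono_set hDD')
    simp only [hF, hsum]
    rw [if_neg (fun h => hs s hsD ((hmem s).1 h)), sub_zero, ← ofReal_norm,
      ENNReal.ofReal_rpow_of_nonneg (norm_nonneg _) hα.le, Real.norm_eq_abs]
  have hcover : (Set.univ : Set ℝ) ⊆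
      ((⋃ j : J, cell j) ∪ Set.Iio (-(Ω : ℝ))) ∪ Set.Ici (Ω : ℝ) := by
    intro s _
    by_cases h1 : s < -(Ω : ℝ)
    · exact Or.inl (Or.inr h1)
    by_cases h2 : (Ω : ℝ) ≤ s
    · exact Or.inr h2
    · exact Or.inl (Or.inl (Set.mem_iUnion.2
        ⟨⟨_, (hmem s).2 ⟨not_lt.1 h1, not_le.1 h2⟩⟩, (mem_Ico_cell_iff hω0 _ s).2 rfl⟩))
  have hIic : ∫⁻ s in Set.Iio (-(Ω : ℝ)), F s ≤
      ENNReal.ofReal (∫ s in Set.Iic (-(Ω : ℝ)), |g s| ^ α) :=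
    hout _ _ measurableSet_Iio Set.Iio_subset_Iic_self
      fun s hs h => not_lt.2 h.1 hs
  have hIci : ∫⁻ s in Set.Ici (Ω : ℝ), F s ≤
      ENNReal.ofReal (∫ s in Set.Ici (Ω : ℝ), |g s| ^ α) :=
    hout _ _ measurableSet_Ici subset_rfl fun s hs h => not_lt.2 hs h.2
  calc ∫⁻ s, F s = ∫⁻ s in Set.univ, F s := by rw [setLIntegral_univ]
    _ ≤ ∫⁻ s in ((⋃ j : J, cell j) ∪ Set.Iio (-(Ω : ℝ))) ∪ Set.Ici (Ω : ℝ), F s :=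
        lintegral_mono_set hcover
    _ ≤ (∑ j ∈ J, ∫⁻ s in cell j, F s) + (∫⁻ s in Set.Iio (-(Ω : ℝ)), F s) +
          ∫⁻ s in Set.Ici (Ω : ℝ), F s := by
        refine (lintegral_union_le _ _ _).trans (add_le_add_left
          ((lintegral_union_le _ _ _).trans (add_le_add_left ?_ _)) _)
        refine (lintegral_iUnion_le _ _).trans (le_of_eq ?_)
        rw [tsum_fintype]
        exact Finset.sum_coe_sort J fun j => ∫⁻ s in cell j, F s
    _ ≤ ENNReal.ofReal (2 * ∑ m ∈ Finset.Icc 1 (ω * Ω), B m) +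
          ENNReal.ofReal (∫ s in Set.Iic (-(Ω : ℝ)), |g s| ^ α) +
          ENNReal.ofReal (∫ s in Set.Ici (Ω : ℝ), |g s| ^ α) := by
        gcongr
    _ = ENNReal.ofReal (errorBound α g γ a c ω Ω) := by
        have h1 : 0 ≤ 2 * ∑ m ∈ Finset.Icc 1 (ω * Ω), B m :=
          mul_nonneg zero_le_two (Finset.sum_nonneg fun m _ => hB0 m)
        have h2 : ∀ D : Set ℝ, 0 ≤ ∫ s in D, |g s| ^ α := fun D =>
          integral_nonneg fun s => by positivity
        rw [← ENNReal.ofReal_add h1 (h2 _), ← ENNReal.ofReal_add (add_nonneg h1 (h2 _)) (h2 _),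
          errorBound, hB, ← Finset.mul_sum]
        congr 3
        ring

/-! ### The error bound for the moving average. -/

theorem proposition5p1 {S : Type*} [MeasurableSpace S] (P : Measure S) [IsProbabilityMeasure P]
    (α : ℝ) (hα : 0 < α) (hα2 : α ≤ 2)
    (M : Set ℝ → S → ℝ) (hM : IsSymStableRandomMeasure α P M)
    (g : ℝ → ℝ) (hg : MemLp g (ENNReal.ofReal α) volume)
    (c₀p c₀m γ a c η : ℝ) (hc : 0 < c) (hη : 0 < η)
    (hγ : 0 < γ + 1 / α) (hγa : γ + 1 / α < a) (ha : a ≤ 1)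
    (hgp : Tendsto (fun r : ℝ => g r / r ^ γ) (𝓝[>] 0) (𝓝 c₀p))
    (hgm : Tendsto (fun r : ℝ => g (-r) / r ^ γ) (𝓝[>] 0) (𝓝 c₀m))
    (hinc : ∀ u h : ℝ, u ≠ 0 → |h| < η → |g (u + h) - g u| ≤ c * |h| ^ a * |u| ^ (γ - a))
    (ω Ω : ℕ) (k : ℤ) (hω : 1 / η < (ω : ℝ)) :
    (∃ σ : ℝ, HasSymStableLaw α σ P
      (fun s => movingAverage α P M g k s - movingAverageApprox M g ω Ω k s)) ∧
    alphaNorm α P (fun s => movingAverage α P M g k s - movingAverageApprox M g ω Ω k s)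
      ≤ errorBound α g γ a c ω Ω ^ (1 / α) := by
  have hω' : (0 : ℝ) < ω := (by positivity : 0 < 1 / η).trans hω
  have hω0 : 0 < ω := by exact_mod_cast hω'
  have hωη : 1 / (ω : ℝ) < η := (one_div_lt hη hω').1 hω
  have ha0 : 0 < a := hγ.trans hγa
  let r : ℤ → ℝ := fun j => if j ≤ 0 then g (((j : ℝ) - 1) / ω) else g ((j : ℝ) / ω)
  let A : ℤ → Set ℝ := fun j =>
    Set.Ioc (((ω * k - j : ℤ) : ℝ) / ω) ((((ω * k - j : ℤ) : ℝ) + 1) / ω)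
  set J := Finset.Icc (-((ω : ℤ) * Ω) + 1) ((ω : ℤ) * Ω) with hJ
  obtain ⟨ψ, hψ, hψe, hψI⟩ := hM.exists_simpleFunc_sum_indicator hα J r A
    (fun j => measurableSet_Ioc) (fun j => by simp [A])
  have happrox : movingAverageApprox M g ω Ω k =ᵐ[P] simpleStableIntegral M ψ := by
    have h := ae_all_iff.2 fun j : ℤ => hM.ae_stableIncrement hα hω0 (ω * k - j)
    filter_upwards [hψI, h] with s h1 h2
    rw [h1, movingAverageApprox, hJ, sum_Icc_neg_add_one (by positivity)]
    congr 1
    · refine Finset.sum_congr rfl fun j hj => ?_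
      rw [Finset.mem_Icc] at hj
      rw [h2]
      simp [r, A, hj.2]
    · refine Finset.sum_congr rfl fun j hj => ?_
      rw [Finset.mem_Icc] at hj
      rw [h2]
      simp [r, A, show ¬ j ≤ 0 by omega]
  have hgk : MemLp (fun x => g ((k : ℝ) - x)) (ENNReal.ofReal α) volume :=
    hg.comp_measurePreserving (Measure.measurePreserving_sub_left volume (k : ℝ))
  have hY := hM.isStableIntegral_sub_simpleFunc hα
    (hM.isStableIntegral_stableIntegral hα hgk) ψ hψ
  have hlaw := hM.hasSymStableLaw_of_isStableIntegral hα (hgk.sub hψ) hY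
  have hlaw' : HasSymStableLaw α
      (eLpNorm (fun x => g ((k : ℝ) - x) - ψ x) (ENNReal.ofReal α) volume).toReal P
      (fun s => movingAverage α P M g k s - movingAverageApprox M g ω Ω k s) := by
    refine hlaw.congr_ae ?_
    filter_upwards [happrox] with s hs
    rw [hs]
    rfl
  refine ⟨⟨_, hlaw'⟩, ?_⟩
  rw [alphaNorm_eq hα hlaw']
  have hbound : eLpNorm (fun x => g ((k : ℝ) - x) - ψ x) (ENNReal.ofReal α) volume ^ α ≤
      ENNReal.ofReal (errorBound α g γ a c ω Ω) := by
    rw [eLpNorm_ofReal_rpow hα, ← lintegral_sub_left_eq_self _ (k : ℝ)]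
    refine le_of_eq_of_le (lintegral_congr fun s => ?_)
      (lintegral_step_error_le hα ha0 hc hg hinc hωη hω0 Ω r (fun j hj => if_pos hj)
        (fun j hj => if_neg (not_le.2 hj)))
    rw [sub_sub_cancel, hψe]
    congr 3
    refine Finset.sum_congr rfl fun j _ => ?_
    congr 1
    -- The reflection `s = k - x` turns the half-open interval `A j`, closed on the right, into the
    -- `j`-th cell, closed on the left.
    have hiff : (k : ℝ) - s ∈ A j ↔ s ∈ Set.Ico (((j : ℝ) - 1) / ω) ((j : ℝ) / ω) := by
      simp only [A, Set.mem_Ioc, Set.mem_Ico]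
      push_cast
      rw [div_lt_iff₀ hω', le_div_iff₀ hω', div_le_iff₀ hω', lt_div_iff₀ hω']
      constructor <;> rintro ⟨h1, h2⟩ <;> constructor <;> nlinarith
    by_cases h : s ∈ Set.Ico (((j : ℝ) - 1) / ω) ((j : ℝ) / ω)
    · rw [Set.indicator_of_mem h, Set.indicator_of_mem (hiff.2 h)]; rfl
    · rw [Set.indicator_of_notMem h, Set.indicator_of_notMem (fun h' => h (hiff.1 h'))]
  have hE : 0 ≤ errorBound α g γ a c ω Ω := by
    have h1 := mul_pos ha0 hα
    unfold errorBound
    have h2 : ∀ D : Set ℝ, 0 ≤ ∫ s in D, |g s| ^ α := fun D =>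
      integral_nonneg fun s => by positivity
    have h3 := h2 (Set.Iic (-(Ω : ℝ)))
    have h4 := h2 (Set.Ici (Ω : ℝ))
    positivity
  set e := eLpNorm (fun x => g ((k : ℝ) - x) - ψ x) (ENNReal.ofReal α) volume
  have h1 : e.toReal ^ α ≤ errorBound α g γ a c ω Ω := by
    rw [ENNReal.toReal_rpow]
    exact ENNReal.toReal_le_of_le_ofReal hE hbound
  calc e.toReal = (e.toReal ^ α) ^ (1 / α) := by
        rw [← Real.rpow_mul ENNReal.toReal_nonneg, mul_one_div_cancel hα.ne', Real.rpow_one]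
    _ ≤ _ := by
        have : 0 ≤ e.toReal := ENNReal.toReal_nonneg
        gcongr
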